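/- **Proposition.** Let $T\ge 2$, $1\le L\le T-1$ and $1\le \ell\le T-1$ be integers, let $\underline C\ge 0$ and $V>0$ be real numbers, and let $\overline C=\underline C+2V$ and $\overline V=\underline C$. Let $P$ be the set of all $(x,y,u)\in\mathbb R_+^{T}\times\{0,1\}^{T}\times\{0,1\}^{T-1}$, with $x=(x_1,\dots,x_T)$, $y=(y_1,\dots,y_T)$, $u=(u_2,\dots,u_T)$, such that \begin{align*} &\textstyle\sum_{i=t-L+1}^{t}u_i\le y_t && (L+1\le t\le T),\\ &\textstyle\sum_{i=t-\ell+1}^{t}u_i\le 1-y_{t-\ell} && (\ell+1\le t\le T),\\ &y_t-y_{t-1}-u_t\le 0 && (2\le t\le T),\\ &\underline C\,y_t\le x_t\le \overline C\,y_t && (1\le t\le T),\\ &x_t-x_{t-1}\le V y_{t-1}+\overline V(1-y_{t-1}) && (2\le t\le T),\\ &x_{t-1}-x_t\le V y_t+\overline V(1-y_t) && (2\le t\le T). \end{align*} Then, for each integer $t$ with $1\le t\le T-1$, both inequalities \begin{align*} x_{t+1}-x_t&\le \overline V y_{t+1}-\underline C y_t+V\Bigl(y_s-\sum_{i=0}^{j_1}u_{s-i}\Bigr),\\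 x_t-x_{t+1}&\le \overline V y_t-\underline C y_{t+1}+V\Bigl(y_{t+1}-\sum_{i=0}^{j_2}u_{t+1-i}\Bigr), \end{align*} where $s=\min\{t+2,T\}$, $j_1=\min\{s-2,1,L-1,s-t-1\}$ and $j_2=\min\{1,t-1,L-1\}$, are valid and facet-defining for the convex hull $\mathrm{conv}(P)\subseteq\mathbb R^{3T-1}$. Here an inequality is valid for $\mathrm{conv}(P)$ if all points of $\mathrm{conv}(P)$ satisfy it, and it is facet-defining if it is valid and the set of points of $\mathrm{conv}(P)$ that satisfy it with equality is nonempty and has (affine) dimension $\dim\mathrm{conv}(P)-1$. -/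

import Mathlib

/-- The ambient space `ℝ^{3T-1}` of vectors `(x, y, u)`: `x` and `y` are indexed by the periods
`1, …, T` and `u` by the periods `2, …, T`. -/
abbrev UCVec (T : ℕ) : Type :=
  (Finset.Icc 1 T → ℝ) × (Finset.Icc 1 T → ℝ) × (Finset.Icc 2 T → ℝ)

namespace UCVec

variable {T : ℕ}

/-- The generation amount `x_t` (`0` is a placeholder for `t` outside `[1, T]`, never used). -/
noncomputable def x (z : UCVec T) (t : ℕ) : ℝ :=
  if h : t ∈ Finset.Icc 1 T then z.1 ⟨t, h⟩ else 0

/-- The online status `y_t` (`0` is a placeholder for `t` outside `[1, T]`, never used). -/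
noncomputable def y (z : UCVec T) (t : ℕ) : ℝ :=
  if h : t ∈ Finset.Icc 1 T then z.2.1 ⟨t, h⟩ else 0

/-- The start-up indicator `u_t` (`0` is a placeholder for `t` outside `[2, T]`, never used). -/
noncomputable def u (z : UCVec T) (t : ℕ) : ℝ :=
  if h : t ∈ Finset.Icc 2 T then z.2.2 ⟨t, h⟩ else 0

end UCVec

/-- The integrated minimum up and down time and ramping set `P` of a generator: horizon `T`, minimum
up time `L`, minimum down time `l`, generation bounds `Cmin` and `Cmax`, start-up/shut-down ramp
rate `Vbar`, ramp rate `V` in the stable region. -/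
def ucPolytope (T L l : ℕ) (Cmin Cmax Vbar V : ℝ) : Set (UCVec T) :=
  {z |
    (∀ t ∈ Finset.Icc 1 T, 0 ≤ z.x t) ∧
    (∀ t ∈ Finset.Icc 1 T, z.y t = 0 ∨ z.y t = 1) ∧
    (∀ t ∈ Finset.Icc 2 T, z.u t = 0 ∨ z.u t = 1) ∧
    -- minimum up time (here `t + 1 - L` is `t - L + 1`, a period in `[2, t + 1]`)
    (∀ t ∈ Finset.Icc (L + 1) T, ∑ i ∈ Finset.Icc (t + 1 - L) t, z.u i ≤ z.y t) ∧
    -- minimum down time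
    (∀ t ∈ Finset.Icc (l + 1) T, ∑ i ∈ Finset.Icc (t + 1 - l) t, z.u i ≤ 1 - z.y (t - l)) ∧
    -- a start-up happens whenever the generator goes from offline to online
    (∀ t ∈ Finset.Icc 2 T, z.y t - z.y (t - 1) - z.u t ≤ 0) ∧
    -- generation bounds
    (∀ t ∈ Finset.Icc 1 T, -z.x t + Cmin * z.y t ≤ 0) ∧
    (∀ t ∈ Finset.Icc 1 T, z.x t - Cmax * z.y t ≤ 0) ∧
    -- ramp-up and ramp-down limits
    (∀ t ∈ Finset.Icc 2 T,
      z.x t - z.x (t - 1) ≤ V * z.y (t - 1) + Vbar * (1 - z.y (t - 1))) ∧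
    (∀ t ∈ Finset.Icc 2 T,
      z.x (t - 1) - z.x t ≤ V * z.y t + Vbar * (1 - z.y t))}

section Polyhedra

variable {E : Type*} [AddCommGroup E] [Module ℝ E]

/-- The dimension of a set: the dimension of its affine hull. -/
noncomputable def affineDim (K : Set E) : ℕ :=
  Module.finrank ℝ (affineSpan ℝ K).direction

/-- The linear inequality `lhs z ≤ rhs z` is valid for `K`. -/
def IsValidIneq (lhs rhs : E → ℝ) (K : Set E) : Prop :=
  ∀ z ∈ K, lhs z ≤ rhs z

/-- The linear inequality `lhs z ≤ rhs z` defines a facet of the polyhedron `K`: it is valid for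
`K`, and the face on which it is tight is nonempty of dimension one less than that of `K`. -/
def IsFacetDefining (lhs rhs : E → ℝ) (K : Set E) : Prop :=
  IsValidIneq lhs rhs K ∧
    {z ∈ K | lhs z = rhs z}.Nonempty ∧
    affineDim {z ∈ K | lhs z = rhs z} + 1 = affineDim K

end Polyhedra

/-- The period `s = min {t + 2, T}`. -/
def rampUpPeriod (T t : ℕ) : ℕ := min (t + 2) T

/-- The index `j₁ = min {s - 2, 1, L - 1, s - t - 1}` with `s = min {t + 2, T}`; no subtraction
truncates for `1 ≤ t ≤ T - 1` and `1 ≤ L`. -/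
def rampUpIndex (T L t : ℕ) : ℕ :=
  min (min (rampUpPeriod T t - 2) 1) (min (L - 1) (rampUpPeriod T t - t - 1))

/-- The index `j₂ = min {1, t - 1, L - 1}`; no subtraction truncates for `1 ≤ t` and `1 ≤ L`. -/
def rampDownIndex (L t : ℕ) : ℕ :=
  min 1 (min (t - 1) (L - 1))

/-- The right-hand side of the strengthened ramp-up inequality. -/
noncomputable def rampUpRhs (T L : ℕ) (Cmin Vbar V : ℝ) (t : ℕ) (z : UCVec T) : ℝ :=
  Vbar * z.y (t + 1) - Cmin * z.y t
    + V * (z.y (rampUpPeriod T t)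
        - ∑ i ∈ Finset.Icc 0 (rampUpIndex T L t), z.u (rampUpPeriod T t - i))

/-- The right-hand side of the strengthened ramp-down inequality. -/
noncomputable def rampDownRhs (T L : ℕ) (Cmin Vbar V : ℝ) (t : ℕ) (z : UCVec T) : ℝ :=
  Vbar * z.y t - Cmin * z.y (t + 1)
    + V * (z.y (t + 1) - ∑ i ∈ Finset.Icc 0 (rampDownIndex L t), z.u (t + 1 - i))

/-! Both inequalities are instances of one. Put C = `Cmin` = `Vbar`, take (p, q) = (t+1, t) for
ramp-up and (t, t+1) for ramp-down, and let s = min(p+1, T). The slack is then φ = C(y_p - y_q) + V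
g - (x_p - x_q), where g is y_s minus the start-ups in `startupPeriods`.

Validity (`slack_nonneg`): g ≥ 0 always, and the generation bounds and the ramp limit then suffice
unless y_p = y_q = 1. In that case the ramp limit gives x_p - x_q ≤ V, which is enough when g ≥ 1.
Otherwise p is a start-up period or the last period before a shut-down, and `Vbar` = C forces x_p ≤
C ≤ x_q.

Facet (`isFacetDefining_of_span`, `span_tight_sup_eq_top`): φ is linear and 0 is a feasible tight
point, so affine dimensions become dimensions of spans. It suffices that the tight points and one
extra vector span the whole space, and that some feasible point is not tight. The tight points used
have one online interval and amounts C + V w; on the full horizon they are tight exactly when w_p =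
w_q + 1. -/

namespace UCVec

variable {T : ℕ}

lemma x_of_mem (z : UCVec T) {t : ℕ} (h : t ∈ Finset.Icc 1 T) : z.x t = z.1 ⟨t, h⟩ := dif_pos h

lemma y_of_mem (z : UCVec T) {t : ℕ} (h : t ∈ Finset.Icc 1 T) : z.y t = z.2.1 ⟨t, h⟩ := dif_pos h

lemma u_of_mem (z : UCVec T) {t : ℕ} (h : t ∈ Finset.Icc 2 T) : z.u t = z.2.2 ⟨t, h⟩ := dif_pos h

lemma u_of_notMem (z : UCVec T) {t : ℕ} (h : t ∉ Finset.Icc 2 T) : z.u t = 0 := dif_neg h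

lemma x_add (z z' : UCVec T) (t : ℕ) : (z + z').x t = z.x t + z'.x t := by
  unfold x; split_ifs <;> simp

lemma y_add (z z' : UCVec T) (t : ℕ) : (z + z').y t = z.y t + z'.y t := by
  unfold y; split_ifs <;> simp

lemma u_add (z z' : UCVec T) (t : ℕ) : (z + z').u t = z.u t + z'.u t := by
  unfold u; split_ifs <;> simp

lemma x_smul (c : ℝ) (z : UCVec T) (t : ℕ) : (c • z).x t = c * z.x t := by
  unfold x; split_ifs <;> simp

lemma y_smul (c : ℝ) (z : UCVec T) (t : ℕ) : (c • z).y t = c * z.y t := by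
  unfold y; split_ifs <;> simp

lemma u_smul (c : ℝ) (z : UCVec T) (t : ℕ) : (c • z).u t = c * z.u t := by
  unfold u; split_ifs <;> simp

/-- The slack of the inequality
`x_p - x_q ≤ C (y_p - y_q) + V (y_s - ∑_{i ∈ J} u_i)` as a linear functional. -/
noncomputable def slack (T : ℕ) (C V : ℝ) (p q s : ℕ) (J : Finset ℕ) : UCVec T →ₗ[ℝ] ℝ where
  toFun z := C * (z.y p - z.y q) + V * (z.y s - ∑ i ∈ J, z.u i) - (z.x p - z.x q)
  map_add' z z' := by
    simp only [x_add, y_add, u_add, Finset.sum_add_distrib]; ring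
  map_smul' c z := by
    simp only [x_smul, y_smul, u_smul, ← Finset.mul_sum, smul_eq_mul, RingHom.id_apply]; ring

lemma slack_apply (C V : ℝ) (p q s : ℕ) (J : Finset ℕ) (z : UCVec T) :
    slack T C V p q s J z =
      C * (z.y p - z.y q) + V * (z.y s - ∑ i ∈ J, z.u i) - (z.x p - z.x q) := rfl

end UCVec

/-! ### Facets through the origin: from affine dimension to linear span. -/

section Facets

variable {E : Type*} [AddCommGroup E] [Module ℝ E]

lemma convexHull_valid_of_valid (φ : E →ₗ[ℝ] ℝ) {K : Set E} (hK : ∀ z ∈ K, 0 ≤ φ z) :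
    ∀ z ∈ convexHull ℝ K, 0 ≤ φ z :=
  convexHull_min hK (convex_halfSpace_ge φ.isLinear 0)

lemma vectorSpan_eq_span_of_zero_mem {K : Set E} (h0 : (0 : E) ∈ K) :
    vectorSpan ℝ K = Submodule.span ℝ K := by
  rw [vectorSpan_eq_span_vsub_set_right ℝ h0]
  simp

/-- A valid inequality with slack `φ` is facet-defining as soon as the span of the tight points,
enlarged by one vector, is the whole space. -/
lemma isFacetDefining_of_span [FiniteDimensional ℝ E] {lhs rhs : E → ℝ} (φ : E →ₗ[ℝ] ℝ)
    (hφ : ∀ z, φ z = rhs z - lhs z) {K : Set E} (hK : ∀ z ∈ K, 0 ≤ φ z) (h0 : (0 : E) ∈ K)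
    {e : E} (hspan : Submodule.span ℝ {z ∈ K | φ z = 0} ⊔ Submodule.span ℝ {e} = ⊤)
    {z₁ : E} (hz₁ : z₁ ∈ K) (hz₁φ : φ z₁ ≠ 0) :
    IsFacetDefining lhs rhs (convexHull ℝ K) := by
  have hface : {z ∈ convexHull ℝ K | lhs z = rhs z} = {z ∈ convexHull ℝ K | φ z = 0} := by
    ext z
    simp only [Set.mem_ofPred_eq, hφ, sub_eq_zero, eq_comm]
  have hzero : (0 : E) ∈ {z ∈ convexHull ℝ K | φ z = 0} :=
    ⟨subset_convexHull ℝ K h0, map_zero φ⟩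
  have hle : Submodule.span ℝ {z ∈ K | φ z = 0} ≤ LinearMap.ker φ :=
    Submodule.span_le.2 fun z hz => hz.2
  have hker : vectorSpan ℝ {z ∈ convexHull ℝ K | φ z = 0} = LinearMap.ker φ := by
    rw [vectorSpan_eq_span_of_zero_mem hzero]
    refine le_antisymm (Submodule.span_le.2 fun z hz => hz.2) fun z hz => ?_
    have hez : ∀ v : E, ∃ s ∈ Submodule.span ℝ {z ∈ K | φ z = 0}, ∃ c : ℝ, s + c • e = v := by
      intro v
      obtain ⟨s, hs, w, hw, rfl⟩ := Submodule.mem_sup.1 (hspan ▸ Submodule.mem_top : v ∈ _)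
      obtain ⟨c, rfl⟩ := Submodule.mem_span_singleton.1 hw
      exact ⟨s, hs, c, rfl⟩
    -- φ kills the span of the tight points, so if it killed e as well it would vanish at z₁.
    have hφe : φ e ≠ 0 := by
      intro he
      obtain ⟨s, hs, c, rfl⟩ := hez z₁
      exact hz₁φ (by rw [map_add, map_smul, he, LinearMap.mem_ker.1 (hle hs)]; simp)
    obtain ⟨s, hs, c, rfl⟩ := hez z
    have hc : c = 0 := by
      have h := LinearMap.mem_ker.1 hz
      rw [map_add, map_smul, LinearMap.mem_ker.1 (hle hs), zero_add, smul_eq_mul] at h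
      exact (mul_eq_zero.1 h).resolve_right hφe
    rw [hc, zero_smul, add_zero]
    exact Submodule.span_mono (fun z hz => And.intro (subset_convexHull ℝ K hz.1) hz.2) hs
  have hlt : LinearMap.ker φ < vectorSpan ℝ (convexHull ℝ K) := by
    rw [← hker]
    refine lt_of_le_of_ne (vectorSpan_mono ℝ fun z hz => hz.1) fun h => hz₁φ ?_
    have hmem : z₁ ∈ vectorSpan ℝ (convexHull ℝ K) := by
      rw [vectorSpan_eq_span_of_zero_mem (subset_convexHull ℝ K h0)]
      exact Submodule.subset_span (subset_convexHull ℝ K hz₁)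
    rw [← h, hker] at hmem
    exact hmem
  have hfin : Module.finrank ℝ (LinearMap.ker φ) + 1 = Module.finrank ℝ E :=
    Module.Dual.finrank_ker_add_one_of_ne_zero (f := φ) fun h => hz₁φ (by rw [h]; rfl)
  refine ⟨fun z hz => ?_, ?_, ?_⟩
  · have := convexHull_valid_of_valid φ hK z hz
    rw [hφ] at this
    linarith
  · rw [hface]
    exact ⟨0, hzero⟩
  · unfold affineDim
    rw [hface, direction_affineSpan, direction_affineSpan, hker]
    have h1 := Submodule.finrank_lt_finrank_of_lt hlt
    have h2 := Submodule.finrank_le (vectorSpan ℝ (convexHull ℝ K))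
    omega

end Facets

/-! ### A triangular spanning criterion. -/

lemma Submodule.eq_top_of_single_mem {ι : Type*} [Fintype ι] [DecidableEq ι]
    (S : Submodule ℝ (ι → ℝ)) (h : ∀ i, Pi.single i 1 ∈ S) : S = ⊤ := by
  rw [eq_top_iff, ← (Pi.basisFun ℝ ι).span_eq, Submodule.span_le]
  rintro _ ⟨i, rfl⟩
  simpa using h i

/-- A submodule of `UCVec T` is everything if it contains all generation vectors, for each period
`k` a vector with online status `1_{≤ k}` and no start-up, and for each period `k ≥ 2` a vector
whose only start-up is in period `k`. -/
lemma UCVec.submodule_eq_top {T : ℕ} (S : Submodule ℝ (UCVec T))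
    (hx : ∀ i : Finset.Icc 1 T, ((Pi.single i 1, 0, 0) : UCVec T) ∈ S)
    (hy : ∀ k ∈ Finset.Icc 1 T, ∃ a, ((a, fun i => if (i : ℕ) ≤ k then 1 else 0, 0) : UCVec T) ∈ S)
    (hu : ∀ k : Finset.Icc 2 T, ∃ a b, ((a, b, Pi.single k 1) : UCVec T) ∈ S) : S = ⊤ := by
  have hx' : ∀ a, ((a, 0, 0) : UCVec T) ∈ S := by
    have h := Submodule.eq_top_of_single_mem
      (S.comap (LinearMap.inl ℝ (Finset.Icc 1 T → ℝ) _)) hx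
    intro a
    have : a ∈ S.comap (LinearMap.inl ℝ (Finset.Icc 1 T → ℝ) _) := h ▸ Submodule.mem_top
    exact this
  have hstep : ∀ k ≤ T, ((0, fun i => if (i : ℕ) ≤ k then 1 else 0, 0) : UCVec T) ∈ S := by
    intro k hk
    rcases Nat.eq_zero_or_pos k with rfl | hpos
    · convert S.zero_mem using 1
      refine Prod.ext rfl (Prod.ext (funext fun i => ?_) rfl)
      have := (Finset.mem_Icc.1 i.2).1
      exact if_neg (by omega)
    · obtain ⟨a, ha⟩ := hy k (Finset.mem_Icc.2 ⟨hpos, hk⟩)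
      simpa using S.sub_mem ha (hx' a)
  have hy' : ∀ b, ((0, b, 0) : UCVec T) ∈ S := by
    have h := Submodule.eq_top_of_single_mem
      (S.comap ((LinearMap.inr ℝ (Finset.Icc 1 T → ℝ) _).comp
        (LinearMap.inl ℝ (Finset.Icc 1 T → ℝ) (Finset.Icc 2 T → ℝ)))) fun i => by
        have hi := Finset.mem_Icc.1 i.2
        -- A unit status vector is a difference of two consecutive prefixes; for i = 1 the second
        -- prefix is empty.
        have := S.sub_mem (hstep i hi.2) (hstep (i - 1) (by omega))
        rw [Submodule.mem_comap]
        convert this using 1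
        refine Prod.ext (by simp) (Prod.ext (funext fun j => ?_) (by simp))
        have hj := Finset.mem_Icc.1 j.2
        simp only [LinearMap.comp_apply, LinearMap.inr_apply, LinearMap.inl_apply, Prod.fst_sub,
          Prod.snd_sub, Pi.sub_apply, Pi.single_apply, Subtype.ext_iff]
        split_ifs <;> first | omega | norm_num
    intro b
    have : b ∈ S.comap ((LinearMap.inr ℝ (Finset.Icc 1 T → ℝ) _).comp
        (LinearMap.inl ℝ (Finset.Icc 1 T → ℝ) (Finset.Icc 2 T → ℝ))) := h ▸ Submodule.mem_top
    exact this
  have hu' : ∀ c, ((0, 0, c) : UCVec T) ∈ S := by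
    have h := Submodule.eq_top_of_single_mem
      (S.comap ((LinearMap.inr ℝ (Finset.Icc 1 T → ℝ) _).comp
        (LinearMap.inr ℝ (Finset.Icc 1 T → ℝ) (Finset.Icc 2 T → ℝ)))) fun k => by
        obtain ⟨a, b, hab⟩ := hu k
        simpa using S.sub_mem (S.sub_mem hab (hx' a)) (hy' b)
    intro c
    have : c ∈ S.comap ((LinearMap.inr ℝ (Finset.Icc 1 T → ℝ) _).comp
        (LinearMap.inr ℝ (Finset.Icc 1 T → ℝ) (Finset.Icc 2 T → ℝ))) := h ▸ Submodule.mem_top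
    exact this
  rw [eq_top_iff]
  rintro ⟨a, b, c⟩ -
  simpa using S.add_mem (S.add_mem (hx' a) (hy' b)) (hu' c)

/-! ### Logical consequences of the up/down time constraints. -/

section Validity

variable {T L l : ℕ} {Cmin Cmax Vbar V : ℝ} {z : UCVec T}

lemma y_le_of_no_startup (hz : z ∈ ucPolytope T L l Cmin Cmax Vbar V) {a b : ℕ} (ha : 1 ≤ a)
    (hab : a ≤ b) (hb : b ≤ T) (hu : ∀ j, a < j → j ≤ b → z.u j = 0) : z.y b ≤ z.y a := by
  obtain ⟨-, -, -, -, -, hst, -⟩ := hz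
  induction b, hab using Nat.le_induction with
  | base => exact le_rfl
  | succ n hn ih =>
    have h1 := hst (n + 1) (Finset.mem_Icc.2 ⟨by omega, hb⟩)
    rw [hu (n + 1) (by omega) le_rfl, Nat.add_sub_cancel] at h1
    have h2 := ih (by omega) fun j hj hj' => hu j hj (by omega)
    linarith

lemma u_nonneg (hz : z ∈ ucPolytope T L l Cmin Cmax Vbar V) (k : ℕ) : 0 ≤ z.u k := by
  by_cases hk : k ∈ Finset.Icc 2 T
  · rcases hz.2.2.1 k hk with h | h <;> rw [h]
    exact zero_le_one
  · exact (z.u_of_notMem hk).ge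

lemma u_le_sum (hz : z ∈ ucPolytope T L l Cmin Cmax Vbar V) {J : Finset ℕ} {k : ℕ} (hk : k ∈ J) :
    z.u k ≤ ∑ i ∈ J, z.u i :=
  Finset.single_le_sum (fun i _ => u_nonneg hz i) hk

lemma u_eq_zero_of_sum_le_one (hz : z ∈ ucPolytope T L l Cmin Cmax Vbar V) {J : Finset ℕ} {k : ℕ}
    (hk : k ∈ J) (huk : z.u k = 1) (hJ : ∑ i ∈ J, z.u i ≤ 1) {j : ℕ} (hj : j ∈ J) (hjk : j ≠ k) :
    z.u j = 0 := by
  have h := Finset.add_sum_erase J z.u hk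
  have h2 : z.u j ≤ ∑ i ∈ J.erase k, z.u i := u_le_sum hz (Finset.mem_erase.2 ⟨hjk, hj⟩)
  have h3 := u_nonneg hz j
  linarith

/-- A generator started up in period `k` is online in the periods `k, …, k + L - 1`. -/
lemma y_eq_one_of_u_eq_one (hL : L + 1 ≤ T) (hz : z ∈ ucPolytope T L l Cmin Cmax Vbar V)
    {k m : ℕ} (hk : 2 ≤ k) (hkm : k ≤ m) (hm : m ≤ T) (hmL : m < k + L) (huk : z.u k = 1) :
    z.y m = 1 := by
  have hup := hz.2.2.2.1
  have hle : ∀ i ∈ Finset.Icc 1 T, z.y i ≤ 1 := fun i hi => by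
    rcases hz.2.1 i hi with h | h <;> rw [h]
    exact zero_le_one
  have hm1 : z.y m ≤ 1 := hle m (Finset.mem_Icc.2 ⟨by omega, hm⟩)
  refine le_antisymm hm1 ?_
  rcases Nat.lt_or_ge L m with h | h
  · have h1 := hup m (Finset.mem_Icc.2 ⟨h, hm⟩)
    have h2 : z.u k ≤ _ := u_le_sum hz (J := Finset.Icc (m + 1 - L) m) (k := k)
      (Finset.mem_Icc.2 ⟨by omega, hkm⟩)
    linarith
  -- No up-time constraint exists at m ≤ L. The one at L + 1 has k in its window, which excludes any
  -- other start-up there, so status cannot rise between m and L + 1.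
  · have h1 := hup (L + 1) (Finset.mem_Icc.2 ⟨le_rfl, hL⟩)
    have hkJ : k ∈ Finset.Icc (L + 1 + 1 - L) (L + 1) := Finset.mem_Icc.2 ⟨by omega, by omega⟩
    have h2 : z.u k ≤ _ := u_le_sum hz hkJ
    have h3 := hle (L + 1) (Finset.mem_Icc.2 ⟨by omega, hL⟩)
    have h4 := y_le_of_no_startup hz (a := m) (b := L + 1) (by omega) (by omega) hL
      fun j hj hj' => u_eq_zero_of_sum_le_one hz hkJ huk (h1.trans h3)
        (Finset.mem_Icc.2 ⟨by omega, hj'⟩) (by omega)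
    linarith

/-- A generator started up in period `k` is offline in period `k - 1`. -/
lemma y_pred_eq_zero_of_u_eq_one (hl1 : 1 ≤ l) (hl : l + 1 ≤ T)
    (hz : z ∈ ucPolytope T L l Cmin Cmax Vbar V) {k : ℕ} (hk : 2 ≤ k) (hkT : k ≤ T)
    (huk : z.u k = 1) : z.y (k - 1) = 0 := by
  have hdown := hz.2.2.2.2.1
  have hge : ∀ i ∈ Finset.Icc 1 T, 0 ≤ z.y i := fun i hi => by
    rcases hz.2.1 i hi with h | h <;> rw [h]
    exact zero_le_one
  refine le_antisymm ?_ (hge (k - 1) (Finset.mem_Icc.2 ⟨by omega, by omega⟩))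
  rcases Nat.lt_or_ge T (k + l - 1) with h | h
  -- The down-time window starting at k would run past T. The last window contains k and allows no
  -- other start-up, so the generator, offline at T - l, stays offline until k - 1.
  · have h1 := hdown T (Finset.mem_Icc.2 ⟨hl, le_rfl⟩)
    have hkJ : k ∈ Finset.Icc (T + 1 - l) T := Finset.mem_Icc.2 ⟨by omega, by omega⟩
    have h2 : z.u k ≤ _ := u_le_sum hz hkJ
    have h3 := hge (T - l) (Finset.mem_Icc.2 ⟨by omega, by omega⟩)
    have h4 := y_le_of_no_startup hz (a := T - l) (b := k - 1) (by omega) (by omega) (by omega)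
      fun j hj hj' => u_eq_zero_of_sum_le_one hz hkJ huk (by linarith)
        (Finset.mem_Icc.2 ⟨by omega, by omega⟩) (by omega)
    linarith
  · have h1 := hdown (k + l - 1) (Finset.mem_Icc.2 ⟨by omega, h⟩)
    have h2 : z.u k ≤ _ := u_le_sum hz (J := Finset.Icc (k + l - 1 + 1 - l) (k + l - 1)) (k := k)
      (Finset.mem_Icc.2 ⟨by omega, by omega⟩)
    rw [show k + l - 1 - l = k - 1 by omega] at h1
    linarith

end Validity

/-! ### Validity of the common form of the two inequalities. -/

/-- The number of start-up terms, minus one, in the strengthened ramping inequality that bounds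
`x_p - x_{p ± 1}`, for `s = min (p + 1) T`. -/
def startupIndex (T L p : ℕ) : ℕ :=
  min (min 1 (L - 1)) (min (p - 1) (min (p + 1) T - p))

/-- The start-up periods in the strengthened ramping inequality that bounds `x_p - x_{p ± 1}`. -/
def startupPeriods (T L p : ℕ) : Finset ℕ :=
  Finset.Icc (min (p + 1) T - startupIndex T L p) (min (p + 1) T)

lemma startupPeriods_cases {T L p : ℕ} (hL : 1 ≤ L) (hp : 1 ≤ p) (hpT : p ≤ T) :
    (p = T ∧ min (p + 1) T = p ∧ startupPeriods T L p = {p}) ∨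
    (p < T ∧ min (p + 1) T = p + 1 ∧ (p = 1 ∨ L = 1) ∧ startupPeriods T L p = {p + 1}) ∨
    (p < T ∧ min (p + 1) T = p + 1 ∧ 2 ≤ p ∧ 2 ≤ L ∧ startupPeriods T L p = {p, p + 1}) := by
  unfold startupPeriods startupIndex
  rcases Nat.lt_or_ge p T with h | h
  · have h1 : min (p + 1) T = p + 1 := by omega
    rw [h1]
    by_cases h2 : p = 1 ∨ L = 1
    · refine Or.inr (Or.inl ⟨h, rfl, h2, ?_⟩)
      rw [show min (min 1 (L - 1)) (min (p - 1) (p + 1 - p)) = 0 by omega]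
      simp
    · refine Or.inr (Or.inr ⟨h, rfl, by omega, by omega, ?_⟩)
      rw [show min (min 1 (L - 1)) (min (p - 1) (p + 1 - p)) = 1 by omega]
      ext i
      simp only [Finset.mem_Icc, Finset.mem_insert, Finset.mem_singleton]
      omega
  · have h1 : min (p + 1) T = p := by omega
    rw [h1]
    refine Or.inl ⟨by omega, rfl, ?_⟩
    rw [show min (min 1 (L - 1)) (min (p - 1) (p - p)) = 0 by omega]
    simp

/-- Validity of the strengthened ramping inequalities, in both directions. -/
lemma slack_nonneg {T L l : ℕ} {Cmin V : ℝ} (hL1 : 1 ≤ L) (hL : L + 1 ≤ T) (hl1 : 1 ≤ l)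
    (hl : l + 1 ≤ T) (hV : 0 < V) {p q : ℕ} (hp : 1 ≤ p) (hpT : p ≤ T)
    (hq : 1 ≤ q) (hqT : q ≤ T) (hpq : p = q + 1 ∨ q = p + 1) {z : UCVec T}
    (hz : z ∈ ucPolytope T L l Cmin (Cmin + 2 * V) Cmin V) :
    0 ≤ UCVec.slack T Cmin V p q (min (p + 1) T) (startupPeriods T L p) z := by
  rw [UCVec.slack_apply]
  set g := z.y (min (p + 1) T) - ∑ i ∈ startupPeriods T L p, z.u i with hg
  have hF1 := fun k => y_pred_eq_zero_of_u_eq_one hl1 hl hz (k := k)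
  have hF2 := fun k m => y_eq_one_of_u_eq_one hL hz (k := k) (m := m)
  obtain ⟨-, hy, hu, -, -, -, hlb, hub, hru, hrd⟩ := hz
  have hlbq := hlb q (Finset.mem_Icc.2 ⟨hq, hqT⟩)
  have hubp := hub p (Finset.mem_Icc.2 ⟨hp, hpT⟩)
  have hyp := hy p (Finset.mem_Icc.2 ⟨hp, hpT⟩)
  have hyq := hy q (Finset.mem_Icc.2 ⟨hq, hqT⟩)
  have hramp : z.x p - z.x q ≤ V * z.y q + Cmin * (1 - z.y q) := by
    rcases hpq with rfl | rfl
    · exact hru (q + 1) (Finset.mem_Icc.2 ⟨by omega, hpT⟩)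
    · exact hrd (p + 1) (Finset.mem_Icc.2 ⟨by omega, hqT⟩)
  -- Shutting down after p leaves only the shut-down rate, here equal to `Cmin`.
  have hoff : p < T → z.y (p + 1) = 0 → z.x p ≤ Cmin := by
    intro hlt h0
    have h1 := hrd (p + 1) (Finset.mem_Icc.2 ⟨by omega, hlt⟩)
    have h2 := hub (p + 1) (Finset.mem_Icc.2 ⟨by omega, hlt⟩)
    rw [Nat.add_sub_cancel] at h1
    rw [h0] at h1 h2
    linarith
  suffices h : 0 ≤ g ∧ (z.y p = 1 → z.y q = 1 → 1 ≤ g ∨ z.x p ≤ Cmin) by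
    obtain ⟨h0, h1⟩ := h
    have hVg : 0 ≤ V * g := mul_nonneg hV.le h0
    rcases hyp with hyp | hyp
    · rw [hyp] at hubp ⊢
      linarith
    · rcases hyq with hyq | hyq
      · rw [hyq] at hramp hlbq ⊢
        rw [hyp]
        linarith
      · rw [hyq] at hramp hlbq ⊢
        rw [hyp]
        rcases h1 hyp hyq with h | h
        · have := mul_le_mul_of_nonneg_left h hV.le
          linarith
        · linarith
  rcases startupPeriods_cases hL1 hp hpT with
    ⟨rfl, hs, hJ⟩ | ⟨hlt, hs, -, hJ⟩ | ⟨hlt, hs, h2, h3, hJ⟩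
  · obtain rfl : p = q + 1 := by omega
    rw [hs, hJ, Finset.sum_singleton] at hg
    have hF1p := hF1 (q + 1) (by omega) hpT
    have hF2p := hF2 (q + 1) (q + 1) (by omega) le_rfl hpT (by omega)
    rw [Nat.add_sub_cancel] at hF1p
    rcases hu (q + 1) (Finset.mem_Icc.2 ⟨by omega, hpT⟩) with h | h
    · refine ⟨by rcases hyp with h' | h' <;> linarith, fun h' _ => Or.inl (by linarith)⟩
    · exact ⟨by linarith [hF2p h], fun _ h' => by linarith [hF1p h]⟩
  · rw [hs, hJ, Finset.sum_singleton] at hg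
    have hF1p := hF1 (p + 1) (by omega) hlt
    have hF2p := hF2 (p + 1) (p + 1) (by omega) le_rfl hlt (by omega)
    rw [Nat.add_sub_cancel] at hF1p
    rcases hu (p + 1) (Finset.mem_Icc.2 ⟨by omega, hlt⟩) with h | h
    · rcases hy (p + 1) (Finset.mem_Icc.2 ⟨by omega, hlt⟩) with h' | h'
      · exact ⟨by linarith, fun _ _ => Or.inr (hoff hlt h')⟩
      · exact ⟨by linarith, fun _ _ => Or.inl (by linarith)⟩
    · exact ⟨by linarith [hF2p h], fun h' _ => by linarith [hF1p h]⟩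
  · rw [hs, hJ, Finset.sum_pair (by omega)] at hg
    have hF1p := hF1 (p + 1) (by omega) hlt
    have hF2p := hF2 (p + 1) (p + 1) (by omega) le_rfl hlt (by omega)
    have hF2p' := hF2 p p h2 le_rfl hpT (by omega)
    have hF2s := hF2 p (p + 1) h2 (by omega) hlt (by omega)
    rw [Nat.add_sub_cancel] at hF1p
    have hon : z.u p = 1 → z.x p ≤ Cmin := by
      intro h
      have h0 := hF1 p h2 hpT h
      have h1 := hru p (Finset.mem_Icc.2 ⟨h2, hpT⟩)
      have h4 := hub (p - 1) (Finset.mem_Icc.2 ⟨by omega, by omega⟩)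
      rw [h0] at h1 h4
      linarith
    rcases hu (p + 1) (Finset.mem_Icc.2 ⟨by omega, hlt⟩) with h | h
    · rcases hu p (Finset.mem_Icc.2 ⟨h2, hpT⟩) with hup | hup
      · rcases hy (p + 1) (Finset.mem_Icc.2 ⟨by omega, hlt⟩) with h' | h'
        · exact ⟨by linarith, fun _ _ => Or.inr (hoff hlt h')⟩
        · exact ⟨by linarith, fun _ _ => Or.inl (by linarith)⟩
      · exact ⟨by linarith [hF2s hup], fun _ _ => Or.inr (hon hup)⟩
    · rcases hu p (Finset.mem_Icc.2 ⟨h2, hpT⟩) with hup | hup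
      · exact ⟨by linarith [hF2p h], fun h' _ => by linarith [hF1p h]⟩
      -- Start-ups in both p and p + 1 would make y_p equal to 1 and 0 at once.
      · linarith [hF1p h, hF2p' hup]

/-! ### Schedules with a single online interval. -/

/-- The schedule that is online exactly in the periods `a, …, b`, at generation amounts
`C + V * w i`; its only start-up is in period `a`, if `2 ≤ a`. -/
noncomputable def intervalSchedule (T : ℕ) (C V : ℝ) (a b : ℕ) (w : ℕ → ℝ) : UCVec T :=
  (fun i => if a ≤ i ∧ (i : ℕ) ≤ b then C + V * w i else 0,
    fun i => if a ≤ i ∧ (i : ℕ) ≤ b then 1 else 0,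
    fun i => if (i : ℕ) = a then 1 else 0)

section IntervalSchedule

variable {T : ℕ} {C V : ℝ} {a b : ℕ} {w : ℕ → ℝ}

lemma intervalSchedule_x {i : ℕ} (hi : i ∈ Finset.Icc 1 T) :
    (intervalSchedule T C V a b w).x i = if a ≤ i ∧ i ≤ b then C + V * w i else 0 :=
  UCVec.x_of_mem _ hi

lemma intervalSchedule_y {i : ℕ} (hi : i ∈ Finset.Icc 1 T) :
    (intervalSchedule T C V a b w).y i = if a ≤ i ∧ i ≤ b then 1 else 0 :=
  UCVec.y_of_mem _ hi

lemma intervalSchedule_u {i : ℕ} (hi : i ∈ Finset.Icc 2 T) :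
    (intervalSchedule T C V a b w).u i = if i = a then 1 else 0 :=
  UCVec.u_of_mem _ hi

lemma intervalSchedule_sum_u {J : Finset ℕ} (hJ : J ⊆ Finset.Icc 2 T) :
    ∑ i ∈ J, (intervalSchedule T C V a b w).u i = if a ∈ J then 1 else 0 := by
  rw [Finset.sum_congr rfl fun i hi => intervalSchedule_u (hJ hi), Finset.sum_ite_eq']

/-- In units of V above C, the ramp limits ask that w change by at most 1 per period, and the
capacity that it lie in [0, 2]. Since start-up and shut-down rates equal C, w must vanish where the
run starts or stops inside the horizon. -/
lemma intervalSchedule_mem {L l : ℕ} (hC : 0 ≤ C) (hV : 0 < V) (hL : 1 ≤ L) (hl : 1 ≤ l)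
    (ha : 1 ≤ a) (hup : a = 1 ∨ T ≤ b ∨ a + L ≤ b + 1)
    (hw0 : ∀ i, 0 ≤ w i) (hw2 : ∀ i, w i ≤ 2) (hwu : ∀ i, w (i + 1) ≤ w i + 1)
    (hwd : ∀ i, w i ≤ w (i + 1) + 1) (hwa : 2 ≤ a → w a = 0) (hwb : b < T → w b = 0) :
    intervalSchedule T C V a b w ∈ ucPolytope T L l C (C + 2 * V) C V := by
  have hVw0 : ∀ i, 0 ≤ V * w i := fun i => mul_nonneg hV.le (hw0 i)
  have hVw2 : ∀ i, V * w i ≤ 2 * V := fun i => by nlinarith [hw2 i]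
  have hVwu : ∀ i, V * w (i + 1) ≤ V * w i + V := fun i => by nlinarith [hwu i]
  have hVwd : ∀ i, V * w i ≤ V * w (i + 1) + V := fun i => by nlinarith [hwd i]
  refine ⟨fun i hi => ?_, fun i hi => ?_, fun i hi => ?_, fun i hi => ?_, fun i hi => ?_,
    fun i hi => ?_, fun i hi => ?_, fun i hi => ?_, fun i hi => ?_, fun i hi => ?_⟩
  · rw [intervalSchedule_x hi]
    split_ifs
    · linarith [hVw0 i]
    · exact le_rfl
  · rw [intervalSchedule_y hi]
    split_ifs <;> simp
  · rw [intervalSchedule_u hi]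
    split_ifs <;> simp
  · rw [Finset.mem_Icc] at hi
    rw [intervalSchedule_y (Finset.mem_Icc.2 ⟨by omega, hi.2⟩),
      intervalSchedule_sum_u (Finset.Icc_subset_Icc (by omega) hi.2)]
    simp only [Finset.mem_Icc]
    split_ifs <;> first | omega | norm_num
  · rw [Finset.mem_Icc] at hi
    rw [intervalSchedule_y (Finset.mem_Icc.2 ⟨by omega, by omega⟩),
      intervalSchedule_sum_u (Finset.Icc_subset_Icc (by omega) hi.2)]
    simp only [Finset.mem_Icc]
    split_ifs <;> first | omega | norm_num
  · have hi' := Finset.mem_Icc.1 hi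
    rw [intervalSchedule_y (Finset.mem_Icc.2 ⟨by omega, hi'.2⟩),
      intervalSchedule_y (Finset.mem_Icc.2 ⟨by omega, by omega⟩), intervalSchedule_u hi]
    split_ifs <;> first | omega | norm_num
  · rw [intervalSchedule_x hi, intervalSchedule_y hi]
    split_ifs <;> linarith [hVw0 i]
  · rw [intervalSchedule_x hi, intervalSchedule_y hi]
    split_ifs <;> linarith [hVw2 i]
  · obtain ⟨hi1, hi2⟩ := Finset.mem_Icc.1 hi
    obtain ⟨k, rfl⟩ : ∃ k, i = k + 1 := ⟨i - 1, by omega⟩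
    rw [Nat.add_sub_cancel]
    have hk1 : k ∈ Finset.Icc 1 T := Finset.mem_Icc.2 ⟨by omega, by omega⟩
    have hk2 : k + 1 ∈ Finset.Icc 1 T := Finset.mem_Icc.2 ⟨by omega, by omega⟩
    rw [intervalSchedule_x hk1, intervalSchedule_x hk2, intervalSchedule_y hk1]
    split_ifs with h1 h2 h2
    · linarith [hVwu k]
    · obtain rfl : a = k + 1 := by omega
      rw [hwa (by omega)]
      linarith
    · linarith [hVw0 k]
    · linarith
  · obtain ⟨hi1, hi2⟩ := Finset.mem_Icc.1 hi
    obtain ⟨k, rfl⟩ : ∃ k, i = k + 1 := ⟨i - 1, by omega⟩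
    rw [Nat.add_sub_cancel]
    have hk1 : k ∈ Finset.Icc 1 T := Finset.mem_Icc.2 ⟨by omega, by omega⟩
    have hk2 : k + 1 ∈ Finset.Icc 1 T := Finset.mem_Icc.2 ⟨by omega, by omega⟩
    rw [intervalSchedule_x hk1, intervalSchedule_x hk2, intervalSchedule_y hk2]
    split_ifs with h1 h2 h2
    · linarith [hVwd k]
    · obtain rfl : b = k := by omega
      rw [hwb (by omega)]
      linarith
    · linarith [hVw0 (k + 1)]
    · linarith

/-- The slack of an interval schedule in the strengthened ramping inequality. -/
lemma slack_intervalSchedule {L p q : ℕ} (hL : 1 ≤ L) (hT : 2 ≤ T) (hp : 1 ≤ p) (hpT : p ≤ T)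
    (hq : 1 ≤ q) (hqT : q ≤ T) :
    UCVec.slack T C V p q (min (p + 1) T) (startupPeriods T L p) (intervalSchedule T C V a b w) =
      V * ((if a ≤ min (p + 1) T ∧ min (p + 1) T ≤ b then 1 else 0)
        - (if a ∈ startupPeriods T L p then 1 else 0)
        - (if a ≤ p ∧ p ≤ b then w p else 0) + (if a ≤ q ∧ q ≤ b then w q else 0)) := by
  have hsub : startupPeriods T L p ⊆ Finset.Icc 2 T := by
    rcases startupPeriods_cases hL hp hpT with ⟨_, _, h⟩ | ⟨_, _, _, h⟩ | ⟨_, _, _, _, h⟩ <;>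
    · rw [h]
      intro i hi
      simp only [Finset.mem_insert, Finset.mem_singleton] at hi
      rw [Finset.mem_Icc]
      omega
  rw [UCVec.slack_apply, intervalSchedule_sum_u hsub,
    intervalSchedule_y (i := min (p + 1) T) (Finset.mem_Icc.2 ⟨by omega, by omega⟩),
    intervalSchedule_y (i := p) (Finset.mem_Icc.2 ⟨hp, hpT⟩),
    intervalSchedule_y (i := q) (Finset.mem_Icc.2 ⟨hq, hqT⟩),
    intervalSchedule_x (Finset.mem_Icc.2 ⟨hp, hpT⟩),
    intervalSchedule_x (Finset.mem_Icc.2 ⟨hq, hqT⟩)]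
  split_ifs <;> ring

end IntervalSchedule

/-! ### Enough tight points to span. -/

/-- The tight points, together with the generation unit vector of period `p`, span the space. -/
lemma span_tight_sup_eq_top {T L l : ℕ} {C V : ℝ} (hC : 0 ≤ C) (hV : 0 < V) (hT : 2 ≤ T)
    (hL : 1 ≤ L) (hl : 1 ≤ l) {p q : ℕ} (hp : p ∈ Finset.Icc 1 T) (hq : q ∈ Finset.Icc 1 T)
    (hpq : p = q + 1 ∨ q = p + 1) :
    Submodule.span ℝ {z ∈ ucPolytope T L l C (C + 2 * V) C V |
      UCVec.slack T C V p q (min (p + 1) T) (startupPeriods T L p) z = 0} ⊔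
      Submodule.span ℝ {((Pi.single ⟨p, hp⟩ 1, 0, 0) : UCVec T)} = ⊤ := by
  obtain ⟨hp1, hpT⟩ := Finset.mem_Icc.1 hp
  obtain ⟨hq1, hqT⟩ := Finset.mem_Icc.1 hq
  set S := Submodule.span ℝ {z ∈ ucPolytope T L l C (C + 2 * V) C V |
      UCVec.slack T C V p q (min (p + 1) T) (startupPeriods T L p) z = 0} ⊔
      Submodule.span ℝ {((Pi.single ⟨p, hp⟩ 1, 0, 0) : UCVec T)} with hS
  have hmem : ∀ {z}, z ∈ ucPolytope T L l C (C + 2 * V) C V →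
      UCVec.slack T C V p q (min (p + 1) T) (startupPeriods T L p) z = 0 → z ∈ S :=
    fun h h' => Submodule.mem_sup_left (Submodule.subset_span ⟨h, h'⟩)
  have hcases := startupPeriods_cases hL hp1 hpT
  have hfull : ∀ w : ℕ → ℝ, (∀ i, 0 ≤ w i) → (∀ i, w i ≤ 2) → (∀ i, w (i + 1) ≤ w i + 1) →
      (∀ i, w i ≤ w (i + 1) + 1) → w p = w q + 1 → intervalSchedule T C V 1 T w ∈ S := by
    intro w h0 h2 hu hd h
    refine hmem (intervalSchedule_mem hC hV hL hl le_rfl (Or.inl rfl) h0 h2 hu hd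
      (fun h => by omega) (fun h => by omega)) ?_
    rw [slack_intervalSchedule hL hT hp1 hpT hq1 hqT, if_pos ⟨by omega, by omega⟩, if_neg,
      if_pos ⟨hp1, hpT⟩, if_pos ⟨hq1, hqT⟩, h]
    · ring
    · rcases hcases with ⟨_, _, h⟩ | ⟨_, _, _, h⟩ | ⟨_, _, _, _, h⟩ <;>
      · rw [h]
        simp only [Finset.mem_insert, Finset.mem_singleton]
        omega
  -- Here c is the value of g. Raising period p alone by c makes the run tight; for c = 1 this needs
  -- p to be neither a start-up nor a shut-down end of the run.
  have hpulse : ∀ a b : ℕ, ∀ c : ℝ, 1 ≤ a → (a = 1 ∨ T ≤ b ∨ a + L ≤ b + 1) →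
      (c = 0 ∨ c = 1 ∧ (2 ≤ a → a ≠ p) ∧ (b < T → b ≠ p) ∧ a ≤ p ∧ p ≤ b) →
      ((if a ≤ min (p + 1) T ∧ min (p + 1) T ≤ b then 1 else 0)
        - (if a ∈ startupPeriods T L p then 1 else 0) : ℝ) = c →
      intervalSchedule T C V a b (Pi.single p c) ∈ S := by
    intro a b c ha hab hc hg
    have hc01 : 0 ≤ c ∧ c ≤ 1 := by rcases hc with h | h <;> constructor <;> linarith
    refine hmem (intervalSchedule_mem hC hV hL hl ha hab (fun i => ?_) (fun i => ?_) (fun i => ?_)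
      (fun i => ?_) (fun h => ?_) (fun h => ?_)) ?_
    iterate 4
      simp only [Pi.single_apply]
      split_ifs <;> linarith
    · rcases hc with rfl | hc
      · simp
      · exact Pi.single_eq_of_ne (hc.2.1 h) _
    · rcases hc with rfl | hc
      · simp
      · exact Pi.single_eq_of_ne (hc.2.2.1 h) _
    · rw [slack_intervalSchedule hL hT hp1 hpT hq1 hqT, hg, Pi.single_eq_same,
        Pi.single_eq_of_ne (by omega : q ≠ p)]
      rcases hc with rfl | hc
      · simp
      · rw [if_pos hc.2.2.2]
        simp
  have he : ((Pi.single ⟨p, hp⟩ 1, 0, 0) : UCVec T) ∈ S :=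
    Submodule.mem_sup_right (Submodule.mem_span_singleton_self _)
  -- A base profile with room to lower by 1/2 either one entry outside {p, q} or the entries p and q
  -- together. The differences are V/2 times e_i or e_p + e_q, whence the factor 2/V below.
  set w₀ : ℕ → ℝ := fun i => if i = p then 3 / 2 else if i = q then 1 / 2 else 1 with hw₀
  have hbase : intervalSchedule T C V 1 T w₀ ∈ S := by
    refine hfull _ (fun i => ?_) (fun i => ?_) (fun i => ?_) (fun i => ?_) ?_ <;>
    · simp only [hw₀]
      split_ifs <;> first | omega | norm_num
  refine UCVec.submodule_eq_top S (fun i => ?_) (fun k hk => ?_) (fun k => ?_)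
  · by_cases hip : (i : ℕ) = p
    · obtain rfl : i = ⟨p, hp⟩ := Subtype.ext hip
      exact he
    by_cases hiq : (i : ℕ) = q
    · have h : intervalSchedule T C V 1 T (fun j => if j = p then 1 else if j = q then 0 else 1)
          ∈ S := by
        refine hfull _ (fun i => ?_) (fun i => ?_) (fun i => ?_) (fun i => ?_) ?_ <;>
        · split_ifs <;> first | omega | norm_num
      have h' := S.sub_mem (S.smul_mem (2 / V) (S.sub_mem hbase h)) he
      convert h' using 1
      refine Prod.ext (funext fun j => ?_) (Prod.ext ?_ ?_)
      · have hj := Finset.mem_Icc.1 j.2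
        simp only [intervalSchedule, hw₀, Prod.fst_sub, Prod.smul_fst, Pi.sub_apply, Pi.smul_apply,
          smul_eq_mul, Pi.single_apply, Subtype.ext_iff, hiq, hj, and_self, if_true]
        split_ifs <;> first | omega | (field_simp; ring)
      · simp [intervalSchedule]
      · simp [intervalSchedule]
    · have h : intervalSchedule T C V 1 T (fun j => if j = i then 1 / 2 else w₀ j) ∈ S := by
        refine hfull _ (fun i => ?_) (fun i => ?_) (fun i => ?_) (fun i => ?_) ?_ <;>
        · simp only [hw₀]
          split_ifs <;> first | omega | norm_num
      have h' := S.smul_mem (2 / V) (S.sub_mem hbase h)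
      convert h' using 1
      refine Prod.ext (funext fun j => ?_) (Prod.ext ?_ ?_)
      · have hj := Finset.mem_Icc.1 j.2
        simp only [intervalSchedule, hw₀, Prod.fst_sub, Prod.smul_fst, Pi.sub_apply, Pi.smul_apply,
          smul_eq_mul, Pi.single_apply, Subtype.ext_iff, hj, and_self, if_true]
        split_ifs <;> first | omega | (field_simp; ring)
      · simp [intervalSchedule]
      · simp [intervalSchedule]
  · obtain ⟨hk1, hkT⟩ := Finset.mem_Icc.1 hk
    have h1J : 1 ∉ startupPeriods T L p := by
      rcases hcases with ⟨_, _, h⟩ | ⟨_, _, _, h⟩ | ⟨_, _, _, _, h⟩ <;>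
      · rw [h]
        simp only [Finset.mem_insert, Finset.mem_singleton]
        omega
    have h := hpulse 1 k (if min (p + 1) T ≤ k then 1 else 0) le_rfl (Or.inl rfl)
      (by split_ifs
          · exact Or.inr ⟨rfl, by omega, by omega, by omega, by omega⟩
          · exact Or.inl rfl)
      (by rw [if_neg h1J, sub_zero]
          exact if_congr ⟨fun h => h.2, fun h => ⟨by omega, h⟩⟩ rfl rfl)
    refine ⟨(intervalSchedule T C V 1 k (Pi.single p (if min (p + 1) T ≤ k then 1 else 0))).1, ?_⟩
    convert h using 1
    refine Prod.ext rfl (Prod.ext (funext fun i => ?_) (funext fun i => ?_))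
    · have hi := Finset.mem_Icc.1 i.2
      simp [intervalSchedule, hi.1]
    · have hi := Finset.mem_Icc.1 i.2
      exact (if_neg (by omega)).symm
  · obtain ⟨hk1, hkT⟩ := Finset.mem_Icc.1 k.2
    obtain ⟨b, c, h⟩ : ∃ b c, intervalSchedule T C V k b (Pi.single p c) ∈ S := by
      -- In this exceptional case p is not in `startupPeriods`: a run from p through s would have g
      -- = 1, while the start-up forces w_p = 0, so it is not tight. The run therefore stops at p,
      -- as L = 1 permits.
      by_cases hkp : (k : ℕ) = p ∧ p < T ∧ L = 1
      · refine ⟨p, 0, hpulse k p 0 (by omega) (by omega) (Or.inl rfl) ?_⟩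
        rcases hcases with ⟨_, _, h⟩ | ⟨_, hs, _, h⟩ | ⟨_, _, _, _, h⟩
        · omega
        · rw [h, hs]
          simp only [Finset.mem_singleton]
          rw [if_neg (by omega), if_neg (by omega), sub_zero]
        · omega
      · refine ⟨T, if (k : ℕ) < p then 1 else 0, hpulse k T _ (by omega) (by omega) ?_ ?_⟩
        · split_ifs
          · exact Or.inr ⟨rfl, by omega, by omega, by omega, by omega⟩
          · exact Or.inl rfl
        · rcases hcases with ⟨_, hs, h⟩ | ⟨_, hs, _, h⟩ | ⟨_, hs, _, _, h⟩ <;>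
          · rw [h, hs]
            simp only [Finset.mem_insert, Finset.mem_singleton]
            split_ifs <;> first | omega | norm_num
    refine ⟨(intervalSchedule T C V k b (Pi.single p c)).1,
      (intervalSchedule T C V k b (Pi.single p c)).2.1, ?_⟩
    convert h using 1
    refine Prod.ext rfl (Prod.ext rfl (funext fun i => ?_))
    simp only [intervalSchedule, Pi.single_apply, Subtype.ext_iff]

/-- The strengthened ramping inequalities, in both directions, are facet-defining. -/
lemma isFacetDefining_of_slack {T L l : ℕ} {C V : ℝ} (hC : 0 ≤ C) (hV : 0 < V) (hL1 : 1 ≤ L)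
    (hL : L + 1 ≤ T) (hl1 : 1 ≤ l) (hl : l + 1 ≤ T) {p q : ℕ} (hp : p ∈ Finset.Icc 1 T)
    (hq : q ∈ Finset.Icc 1 T) (hpq : p = q + 1 ∨ q = p + 1) {lhs rhs : UCVec T → ℝ}
    (h : ∀ z, UCVec.slack T C V p q (min (p + 1) T) (startupPeriods T L p) z = rhs z - lhs z) :
    IsFacetDefining lhs rhs (convexHull ℝ (ucPolytope T L l C (C + 2 * V) C V)) := by
  obtain ⟨hp1, hpT⟩ := Finset.mem_Icc.1 hp
  obtain ⟨hq1, hqT⟩ := Finset.mem_Icc.1 hq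
  have hzero : ∀ b, (b < 1 ∨ T ≤ b) →
      intervalSchedule T C V 1 b 0 ∈ ucPolytope T L l C (C + 2 * V) C V := fun b hb =>
    intervalSchedule_mem hC hV hL1 hl1 le_rfl (Or.inl rfl) (by simp) (by simp) (by simp) (by simp)
      (by simp) (by simp)
  refine isFacetDefining_of_span _ h
    (fun z hz => slack_nonneg hL1 hL hl1 hl hV hp1 hpT hq1 hqT hpq hz) ?_
    (span_tight_sup_eq_top hC hV (by omega) hL1 hl1 hp hq hpq) (hzero T (Or.inr le_rfl)) ?_
  · convert hzero 0 (Or.inl one_pos) using 1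
    refine Prod.ext (funext fun i => ?_) (Prod.ext (funext fun i => ?_) (funext fun i => ?_))
    · have hi := Finset.mem_Icc.1 i.2
      exact (if_neg (by omega)).symm
    · have hi := Finset.mem_Icc.1 i.2
      exact (if_neg (by omega)).symm
    · have hi := Finset.mem_Icc.1 i.2
      exact (if_neg (by omega)).symm
  -- The non-tight point is the full-horizon schedule at constant level C, with slack V.
  · rw [slack_intervalSchedule hL1 (by omega) hp1 hpT hq1 hqT, if_pos ⟨by omega, by omega⟩, if_neg]
    · simpa using hV.ne'
    · rcases startupPeriods_cases hL1 hp1 hpT with ⟨_, _, h⟩ | ⟨_, _, _, h⟩ | ⟨_, _, _, _, h⟩ <;>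
      · rw [h]
        simp only [Finset.mem_insert, Finset.mem_singleton]
        omega

lemma Finset.sum_Icc_zero_sub {M : Type*} [AddCommMonoid M] (f : ℕ → M) {s j : ℕ} (hj : j ≤ s) :
    ∑ i ∈ Finset.Icc 0 j, f (s - i) = ∑ i ∈ Finset.Icc (s - j) s, f i := by
  refine Finset.sum_bij' (fun i _ => s - i) (fun i _ => s - i) ?_ ?_ ?_ ?_ fun i _ => rfl <;>
  · intro i hi
    rw [Finset.mem_Icc] at hi
    first | (rw [Finset.mem_Icc]; omega) | omega

theorem mainTheorem6 (T L l : ℕ) (hL : L ∈ Finset.Icc 1 (T - 1)) (hl : l ∈ Finset.Icc 1 (T - 1))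
    (Cmin Cmax Vbar V : ℝ) (hCmin : 0 ≤ Cmin) (hV : 0 < V)
    (hCmax : Cmax = Cmin + 2 * V) (hVbar : Vbar = Cmin)
    (t : ℕ) (ht : t ∈ Finset.Icc 1 (T - 1)) :
    (IsValidIneq (fun z : UCVec T => z.x (t + 1) - z.x t) (rampUpRhs T L Cmin Vbar V t)
        (convexHull ℝ (ucPolytope T L l Cmin Cmax Vbar V)) ∧
      IsFacetDefining (fun z : UCVec T => z.x (t + 1) - z.x t) (rampUpRhs T L Cmin Vbar V t)
        (convexHull ℝ (ucPolytope T L l Cmin Cmax Vbar V))) ∧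
    (IsValidIneq (fun z : UCVec T => z.x t - z.x (t + 1)) (rampDownRhs T L Cmin Vbar V t)
        (convexHull ℝ (ucPolytope T L l Cmin Cmax Vbar V)) ∧
      IsFacetDefining (fun z : UCVec T => z.x t - z.x (t + 1)) (rampDownRhs T L Cmin Vbar V t)
        (convexHull ℝ (ucPolytope T L l Cmin Cmax Vbar V))) := by
  subst hCmax hVbar
  rw [Finset.mem_Icc] at hL hl ht
  have ht1 : t ∈ Finset.Icc 1 T := Finset.mem_Icc.2 ⟨by omega, by omega⟩
  have ht2 : t + 1 ∈ Finset.Icc 1 T := Finset.mem_Icc.2 ⟨by omega, by omega⟩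
  have hup : IsFacetDefining (fun z : UCVec T => z.x (t + 1) - z.x t)
      (rampUpRhs T L Vbar Vbar V t)
      (convexHull ℝ (ucPolytope T L l Vbar (Vbar + 2 * V) Vbar V)) := by
    refine isFacetDefining_of_slack hCmin hV hL.1 (by omega) hl.1 (by omega) ht2 ht1 (Or.inl rfl)
      fun z => ?_
    have hs : rampUpPeriod T t = min (t + 1 + 1) T := rfl
    have hj : rampUpIndex T L t = startupIndex T L (t + 1) := by
      unfold rampUpIndex rampUpPeriod startupIndex
      omega
    have hle : startupIndex T L (t + 1) ≤ min (t + 1 + 1) T := by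
      unfold startupIndex
      omega
    rw [UCVec.slack_apply, rampUpRhs, hs, hj, Finset.sum_Icc_zero_sub z.u hle, startupPeriods]
    ring
  have hdown : IsFacetDefining (fun z : UCVec T => z.x t - z.x (t + 1))
      (rampDownRhs T L Vbar Vbar V t)
      (convexHull ℝ (ucPolytope T L l Vbar (Vbar + 2 * V) Vbar V)) := by
    refine isFacetDefining_of_slack hCmin hV hL.1 (by omega) hl.1 (by omega) ht1 ht2 (Or.inr rfl)
      fun z => ?_
    have hs : min (t + 1) T = t + 1 := by omega
    have hj : rampDownIndex L t = startupIndex T L t := by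
      unfold rampDownIndex startupIndex
      omega
    have hle : startupIndex T L t ≤ t + 1 := by
      unfold startupIndex
      omega
    rw [UCVec.slack_apply, rampDownRhs, hj, Finset.sum_Icc_zero_sub z.u hle, startupPeriods, hs]
    ring
  exact ⟨⟨hup.1, hup⟩, hdown.1, hdown⟩
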